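/- Let $\mathcal M$ be the differential field of meromorphic functions on $\mathbb C$ with the derivation $D = d/dz$, and let $\mathbb C(z) \subseteq \mathcal M$ be the differential subfield of complex rational functions. A function $f \in \mathcal M$ is called differentially transcendental over $\mathbb C(z)$ if there is no non-zero differential polynomial $P$ over $\mathbb C(z)$ (a polynomial with coefficients in $\mathbb C(z)$ in the variables $X, DX, D^2X, \dots$) such that $P(f, Df, D^2 f, \dots) = 0$. The following functions, meromorphically continued to the whole of $\mathbb C$, belong to $\mathcal M$ and are differentially transcendental over $\mathbb C(z)$: 1. the Riemann zeta function $\zeta(s) = \sum_{n\ge 1} n^{-s}$ ($\operatorname{Re}(s)>1$); 2. for every integer $N \ge 1$ and every Dirichlet character $\kappa$ modulo $N$, the Dirichlet $L$-function $L(s,\kappa) = \sum_{n \ge 1} \kappa(n)\, n^{-s}$ ($\operatorname{Re}(s)>1$); 3. the Dirichlet eta function $\eta(s)$, which satisfies $\eta(s) = \sum_{n\ge 1} (-1)^{n+1} n^{-s}$ for $\operatorname{Re}(s) > 1$ and $\eta(s) = (1-2^{1-s})\,\zeta(s)$ for $s \ne 1$; 4. the Dirichlet beta function $\beta(s)$,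 the $L$-function of the non-trivial Dirichlet character modulo $4$, which satisfies $\beta(s) = \sum_{n \ge 0} (-1)^n (2n+1)^{-s}$ for $\operatorname{Re}(s)>1$. -/

import Mathlib

open Filter Topology
open scoped Differential

noncomputable section

namespace DiffTrans

/-! ## Differential algebraic elements -/

/-- Let `K` be a differential field extension of the differential field `F`. An element `b` of `K`
is differentially algebraic over `F` if `p(b, Db, D²b, …) = 0` for some non-zero differential
polynomial `p` over `F`. A differential polynomial in one variable `X` is a polynomial in
`X, DX, D²X, …`, that is, in variables indexed by `ℕ`, the `n`-th of which is `DⁿX`. -/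
def IsDiffAlgebraic (F : Type*) {K : Type*} [Field F] [Field K] [Differential F] [Differential K]
    [Algebra F K] [DifferentialAlgebra F K] (b : K) : Prop :=
  ∃ p : MvPolynomial ℕ F, p ≠ 0 ∧
    MvPolynomial.aeval (fun n : ℕ => (fun y : K => y′)^[n] b) p = 0

/-! ## The differential field of meromorphic functions on the complex plane -/

/-- The algebra of functions `ℂ → ℂ` that are meromorphic at every point (with arbitrary values
at the poles). -/
def meroAlg : Subalgebra ℂ (ℂ → ℂ) where
  carrier := {f | Meromorphic f}
  mul_mem' hf hg := Meromorphic.mul hf hg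
  add_mem' hf hg := Meromorphic.add hf hg
  algebraMap_mem' c := Meromorphic.const c

/-- The ideal of those meromorphic functions that vanish off a closed discrete set. -/
def nullIdeal : Ideal meroAlg where
  carrier := {f | (f : ℂ → ℂ) =ᶠ[codiscrete ℂ] 0}
  zero_mem' := EventuallyEq.refl (codiscrete ℂ) (0 : ℂ → ℂ)
  add_mem' {f g} hf hg := by
    simpa using EventuallyEq.add (show (f : ℂ → ℂ) =ᶠ[codiscrete ℂ] 0 from hf) hg
  smul_mem' c f hf := by
    simpa using EventuallyEq.mul (EventuallyEq.refl (codiscrete ℂ) (c : ℂ → ℂ))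
      (show (f : ℂ → ℂ) =ᶠ[codiscrete ℂ] 0 from hf)

theorem mem_nullIdeal {f : meroAlg} :
    f ∈ nullIdeal ↔ (f : ℂ → ℂ) =ᶠ[codiscrete ℂ] 0 := Iff.rfl

/-- Identity theorem: a meromorphic function on `ℂ` vanishes off a closed discrete set, or is
non-zero off a closed discrete set. -/
theorem eventually_zero_or_ne_zero {f : ℂ → ℂ} (hf : Meromorphic f) :
    f =ᶠ[codiscrete ℂ] 0 ∨ ∀ᶠ z in codiscrete ℂ, f z ≠ 0 := by
  have hf' : MeromorphicOn f Set.univ := hf.meromorphicOn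
  by_cases h : ∀ u ∈ (Set.univ : Set ℂ), meromorphicOrderAt f u ≠ ⊤
  · exact Or.inr (MeromorphicAt.MeromorphicOn.codiscreteWithin_setOfPred_ne_zero hf' h)
  · left
    push Not at h
    obtain ⟨u, hu, htop⟩ := h
    have hall : ∀ x, meromorphicOrderAt f x = ⊤ := by
      intro x
      by_contra hx
      exact hf'.meromorphicOrderAt_ne_top_of_isPreconnected isPreconnected_univ
        (Set.mem_univ x) hu hx htop
    rw [EventuallyEq, Filter.Eventually, codiscrete, mem_codiscreteWithin_iff_forall_mem_nhdsNE]
    intro x _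
    filter_upwards [meromorphicOrderAt_eq_top_iff.1 (hall x)] with y hy
    left
    simpa using hy

instance : NeBot (codiscrete ℂ) := by
  rw [← empty_mem_iff_bot.not.trans neBot_iff.symm, codiscrete,
    mem_codiscreteWithin_iff_forall_mem_nhdsNE]
  intro h
  have h0 := h 0 (Set.mem_univ _)
  simp at h0

/-- The field of meromorphic functions on `ℂ`: functions that are meromorphic at every point, two
of them being identified when they agree off a closed discrete set. -/
def MeroField : Type := meroAlg ⧸ nullIdeal

instance : CommRing MeroField := inferInstanceAs (CommRing (meroAlg ⧸ nullIdeal))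

/-- The class of a meromorphic function, as a ring homomorphism. -/
def meroMk : meroAlg →+* MeroField := Ideal.Quotient.mk nullIdeal

/-- The element of the field of meromorphic functions represented by `f`. -/
def toMero (f : ℂ → ℂ) (hf : Meromorphic f) : MeroField :=
  meroMk ⟨f, hf⟩

theorem toMero_eq_iff {f g : ℂ → ℂ} (hf : Meromorphic f) (hg : Meromorphic g) :
    toMero f hf = toMero g hg ↔ f =ᶠ[codiscrete ℂ] g := by
  refine (Ideal.Quotient.eq (I := nullIdeal)).trans ?_
  rw [mem_nullIdeal]
  change f - g =ᶠ[codiscrete ℂ] 0 ↔ _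
  exact (eventuallyEq_iff_sub).symm

theorem exists_toMero (a : MeroField) : ∃ (f : ℂ → ℂ) (hf : Meromorphic f), toMero f hf = a := by
  obtain ⟨f, rfl⟩ := Ideal.Quotient.mk_surjective (I := nullIdeal) a
  exact ⟨f, f.2, rfl⟩

theorem toMero_add {f g : ℂ → ℂ} (hf : Meromorphic f) (hg : Meromorphic g) :
    toMero f hf + toMero g hg = toMero (f + g) (hf.add hg) := rfl

theorem toMero_mul {f g : ℂ → ℂ} (hf : Meromorphic f) (hg : Meromorphic g) :
    toMero f hf * toMero g hg = toMero (f * g) (hf.mul hg) := rfl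

theorem toMero_zero : toMero 0 (Meromorphic.const (0 : ℂ)) = 0 := rfl

theorem toMero_one : toMero 1 (Meromorphic.const (1 : ℂ)) = 1 := rfl

/-- The inverse of the class of `f` is the class of the pointwise inverse of `f`. -/
instance : Inv MeroField where
  inv := Quotient.lift (fun f : meroAlg => toMero (f : ℂ → ℂ)⁻¹ (Meromorphic.inv f.2)) (by
    intro f g h
    have h' : toMero f f.2 = toMero g g.2 := Quotient.sound h
    refine (toMero_eq_iff _ _).2 ?_
    exact ((toMero_eq_iff _ _).1 h').inv)

theorem toMero_inv {f : ℂ → ℂ} (hf : Meromorphic f) :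
    (toMero f hf)⁻¹ = toMero f⁻¹ hf.inv := rfl

instance : Field MeroField where
  exists_pair_ne := by
    refine ⟨0, 1, fun h => ?_⟩
    rw [← toMero_zero, ← toMero_one, toMero_eq_iff] at h
    obtain ⟨z, hz⟩ := h.exists
    simp at hz
  mul_inv_cancel := by
    intro a ha
    obtain ⟨f, hf, rfl⟩ := exists_toMero a
    rw [toMero_inv, toMero_mul, ← toMero_one, toMero_eq_iff]
    rw [← toMero_zero, ne_eq, toMero_eq_iff] at ha
    filter_upwards [(eventually_zero_or_ne_zero hf).resolve_left ha] with z hz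
    simp [hz]
  inv_zero := by
    rw [← toMero_zero, toMero_inv, toMero_eq_iff]
    exact Eventually.of_forall fun z => by simp
  nnqsmul := _
  nnqsmul_def := fun _ _ => rfl
  qsmul := _
  qsmul_def := fun _ _ => rfl

instance : Algebra ℂ MeroField := (meroMk.comp (algebraMap ℂ meroAlg)).toAlgebra

theorem algebraMap_eq (c : ℂ) :
    algebraMap ℂ MeroField c = toMero (fun _ => c) (Meromorphic.const c) := rfl

theorem eventually_differentiableAt {f : ℂ → ℂ} (hf : Meromorphic f) :
    ∀ᶠ z in codiscrete ℂ, DifferentiableAt ℂ f z := by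
  filter_upwards [(hf.meromorphicOn (s := Set.univ)).eventually_codiscreteWithin_analyticAt f]
    with z hz
  exact hz.differentiableAt

/-- Differentiation of classes of meromorphic functions. -/
def derivFun : MeroField → MeroField :=
  Quotient.lift (fun f : meroAlg => toMero (deriv (f : ℂ → ℂ)) (Meromorphic.deriv f.2)) (by
    intro f g h
    have h' : toMero f f.2 = toMero g g.2 := Quotient.sound h
    refine (toMero_eq_iff _ _).2 ?_
    exact (Meromorphic.meromorphicOn f.2).deriv_eventuallyEq_codiscreteWithin
      (Meromorphic.meromorphicOn g.2) ((toMero_eq_iff _ _).1 h'))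

theorem derivFun_toMero (f : ℂ → ℂ) (hf : Meromorphic f) :
    derivFun (toMero f hf) = toMero (deriv f) hf.deriv := rfl

theorem derivFun_add (a b : MeroField) : derivFun (a + b) = derivFun a + derivFun b := by
  obtain ⟨f, hf, rfl⟩ := exists_toMero a
  obtain ⟨g, hg, rfl⟩ := exists_toMero b
  rw [toMero_add, derivFun_toMero, derivFun_toMero, derivFun_toMero, toMero_add, toMero_eq_iff]
  filter_upwards [eventually_differentiableAt hf, eventually_differentiableAt hg] with z h1 h2
  exact deriv_add h1 h2

theorem derivFun_mul (a b : MeroField) :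
    derivFun (a * b) = a * derivFun b + b * derivFun a := by
  obtain ⟨f, hf, rfl⟩ := exists_toMero a
  obtain ⟨g, hg, rfl⟩ := exists_toMero b
  rw [toMero_mul, derivFun_toMero, derivFun_toMero, derivFun_toMero, toMero_mul, toMero_mul,
    toMero_add, toMero_eq_iff]
  filter_upwards [eventually_differentiableAt hf, eventually_differentiableAt hg] with z h1 h2
  rw [deriv_mul h1 h2]
  simp only [Pi.add_apply, Pi.mul_apply]
  ring

/-- The derivation `d/dz` on the field of meromorphic functions. -/
instance : Differential MeroField where
  deriv := Derivation.mk' (AddMonoidHom.mk' derivFun derivFun_add).toIntLinearMap derivFun_mul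

theorem deriv_toMero (f : ℂ → ℂ) (hf : Meromorphic f) :
    (toMero f hf)′ = toMero (deriv f) hf.deriv := rfl

/-! ## The differential field of complex rational functions -/

theorem meromorphic_id : Meromorphic (fun z : ℂ => z) := fun x => MeromorphicAt.id x

/-- The field `ℂ(z)` of complex rational functions, as the subfield of the field of meromorphic
functions generated by the constants and the identity function `z`. -/
def ratField : IntermediateField ℂ MeroField :=
  IntermediateField.adjoin ℂ {toMero (fun z => z) meromorphic_id}

theorem deriv_mem_ratField {x : MeroField} (hx : x ∈ ratField) : x′ ∈ ratField := by
  induction hx using IntermediateField.adjoin_induction with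
  | mem x hx =>
    obtain rfl := hx
    have : (toMero (fun z => z) meromorphic_id)′ = 1 := by
      rw [deriv_toMero, ← toMero_one, toMero_eq_iff]
      exact Eventually.of_forall fun z => deriv_id z
    rw [this]
    exact one_mem _
  | algebraMap c =>
    have : (algebraMap ℂ MeroField c)′ = 0 := by
      rw [algebraMap_eq, deriv_toMero, ← toMero_zero, toMero_eq_iff]
      refine Eventually.of_forall fun z => ?_
      exact deriv_const z c
    rw [this]
    exact zero_mem _
  | add x y hx hy ihx ihy =>
    rw [map_add]
    exact add_mem ihx ihy
  | inv x hx ih =>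
    rw [Derivation.leibniz_inv]
    rw [smul_eq_mul]
    exact mul_mem (neg_mem (pow_mem (inv_mem hx) _)) ih
  | mul x y hx hy ihx ihy =>
    rw [Derivation.leibniz]
    exact add_mem (mul_mem hx ihy) (mul_mem hy ihx)

/-- The derivation `d/dz` on `ℂ(z)`. -/
instance : Differential ratField where
  deriv := Derivation.mk'
    ({ toFun := fun x => ⟨(x : MeroField)′, deriv_mem_ratField x.2⟩
       map_zero' := Subtype.ext (by simp)
       map_add' := fun x y => Subtype.ext (by simp) } : ratField →+ ratField).toIntLinearMap
    (fun x y => Subtype.ext (by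
      change ((x : MeroField) * (y : MeroField))′ = _
      rw [Derivation.leibniz]
      rfl))

instance : DifferentialAlgebra ratField MeroField where
  deriv_algebraMap _ := rfl

/-- The function `f` is meromorphic on `ℂ` and, as an element of the differential field of
meromorphic functions on `ℂ`, it is not differentially algebraic over `ℂ(z)`. -/
def IsDiffTranscendental (f : ℂ → ℂ) : Prop :=
  ∃ hf : Meromorphic f, ¬ IsDiffAlgebraic ratField (toMero f hf)

/-! ## The eta and beta functions -/

/-- The Dirichlet eta function: the meromorphic continuation to `ℂ` of the Dirichlet series whose
`n`-th coefficient is `-1` for even `n` and `1` for odd `n`. -/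
def dirichletEta (s : ℂ) : ℂ :=
  ZMod.LFunction (fun a : ZMod 2 => if a = 0 then (-1 : ℂ) else 1) s

/-- The non-trivial Dirichlet character modulo `4`, with complex values. -/
def chiFour : DirichletCharacter ℂ 4 := ZMod.χ₄.ringHomComp (Int.castRingHom ℂ)

/-- The Dirichlet beta function: the `L`-function of the non-trivial character modulo `4`. -/
def dirichletBeta (s : ℂ) : ℂ := chiFour.LFunction s

end DiffTrans

end

/-!
The argument is that of Ostrowski. Each of the functions is given for `1 < re s` by an absolutely
convergent Dirichlet series `∑ a n / n ^ s` with periodic coefficients that are non-zero at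
infinitely many primes, and it has at most a simple pole, at `1`. Such a function `f` is shown to be
differentially transcendental (`isDiffTranscendental_of_LSeries`).

It suffices that `z, f, f', f'', …` are algebraically independent over `ℂ`. A relation between them
is a polynomial in `z` whose coefficients are differential polynomials in `f` over `ℂ`, and these
are again convergent Dirichlet series. For the first `m` at which one of these series has a non-zero
coefficient, multiplication by `m ^ s` leaves, as `s` tends to infinity, a polynomial in `s` up to
an exponentially small error. So every one of these series vanishes identically
(`eq_zero_of_sum_pow_mul_LSeries_eq_zero`).

It remains to see that `P (f, f', …) ≠ 0` in the ring of formal Dirichlet series for every non-zero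
`P` over `ℂ` (`algebraicIndependent_derivCoeff`). Let `P` be a counterexample of least degree. Then
not all the series `b i = (∂P/∂X i) (f, f', …)` vanish; let `m` be the first index at which one of
them has a non-zero coefficient. For a prime `p`, multiplication of the `n`-th coefficient by the
exponent of `p` in `n` is a derivation. Applied to `P (f, f', …) = 0` it gives
`∑ i, b i * δ (f^(i)) = 0`, where `δ (f^(i))` is supported at the multiples of `p`. The coefficient
at `m * p` is therefore `∑ i, b i m * (-log p) ^ i * a p = 0`. As this holds for infinitely many
`p` with `a p ≠ 0`, a non-zero polynomial has infinitely many roots, a contradiction.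
-/

noncomputable section

namespace DiffTrans

/-! ### Derivations and partial derivatives of polynomials -/

open MvPolynomial in
/-- The chain rule for a derivation applied to a polynomial expression. -/
theorem derivation_aeval_eq_sum {R A σ : Type*} [CommRing R] [CommRing A] [Algebra R A]
    (D : Derivation R A A) (g : σ → A) (P : MvPolynomial σ R) :
    D (aeval g P) = ∑ i ∈ P.vars, aeval g (pderiv i P) * D (g i) := by
  classical
  suffices h : ∀ Q ∈ supported R (P.vars : Set σ),
      D (aeval g Q) = ∑ i ∈ P.vars, aeval g (pderiv i Q) * D (g i) from h P P.mem_supported_vars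
  intro Q hQ
  induction hQ using Algebra.adjoin_induction with
  | mem x hx =>
    obtain ⟨i, hi, rfl⟩ := hx
    rw [Finset.sum_eq_single_of_mem i hi fun j _ hj => by simp [pderiv_X_of_ne hj.symm]]
    simp
  | algebraMap r => simp
  | add x y _ _ hx hy => simp [hx, hy, add_mul, Finset.sum_add_distrib]
  | mul x y _ _ hx hy =>
    simp only [map_mul, Derivation.leibniz, hx, hy, smul_eq_mul, map_add, add_mul,
      Finset.sum_add_distrib, Finset.mul_sum]
    congr 1 <;> exact Finset.sum_congr rfl fun i _ => by ring

open MvPolynomial in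
theorem totalDegree_pderiv_lt {R σ : Type*} [CommRing R] {P : MvPolynomial σ R} {i : σ}
    (h : pderiv i P ≠ 0) : (pderiv i P).totalDegree < P.totalDegree := by
  classical
  obtain ⟨m, hm, hdeg⟩ := Finset.exists_mem_eq_sup _ (support_nonempty.2 h)
    (fun s : σ →₀ ℕ => s.sum fun _ e => e)
  rw [mem_support_iff, coeff_pderiv] at hm
  have hmem := le_totalDegree (mem_support_iff.2 (left_ne_zero_of_mul hm))
  rw [Finsupp.sum_add_index' (fun _ => rfl) (fun _ _ _ => rfl),
    Finsupp.sum_single_index rfl] at hmem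
  rw [totalDegree, hdeg]
  exact hmem

open MvPolynomial in
theorem eq_C_of_pderiv_eq_zero {R σ : Type*} [CommRing R] [NoZeroDivisors R] [CharZero R]
    {P : MvPolynomial σ R} (h : ∀ i, pderiv i P = 0) : P = C (coeff 0 P) := by
  classical
  ext m
  rw [coeff_C]
  split_ifs with hm
  · rw [hm]
  · obtain ⟨i, hi⟩ := Finsupp.ne_iff.1 (Ne.symm hm)
    have hle : Finsupp.single i 1 ≤ m :=
      Finsupp.single_le_iff.2 (Nat.one_le_iff_ne_zero.2 hi)
    have h1 := coeff_pderiv (i := i) P (m - Finsupp.single i 1)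
    rw [h i, coeff_zero, tsub_add_cancel_of_le hle] at h1
    exact (mul_eq_zero.1 h1.symm).resolve_right (Nat.cast_add_one_ne_zero _)

/-! ### Formal Dirichlet series -/

/-- Multiplication of the `n`-th coefficient by the exponent of `p` in `n`, a derivation of the
Dirichlet convolution ring because this exponent is additive in `n`. -/
def factorizationDerivation (p : ℕ) :
    Derivation ℂ (ArithmeticFunction ℂ) (ArithmeticFunction ℂ) :=
  Derivation.mk'
    { toFun := fun f => ⟨fun n => (n.factorization p : ℂ) * f n, by simp⟩
      map_add' := fun f g => by
        ext n; exact mul_add _ _ _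
      map_smul' := fun c f => by
        ext n; exact mul_left_comm _ _ _ }
    fun f g => by
      ext n
      change (n.factorization p : ℂ) * (f * g) n = (f * _) n + (g * _) n
      rw [mul_comm g, ArithmeticFunction.mul_apply, ArithmeticFunction.mul_apply,
        ArithmeticFunction.mul_apply, Finset.mul_sum, ← Finset.sum_add_distrib]
      refine Finset.sum_congr rfl fun x hx => ?_
      obtain ⟨hx1, hx2⟩ := Nat.mem_divisorsAntidiagonal.1 hx
      rw [← hx1] at hx2 ⊢
      rw [Nat.factorization_mul (left_ne_zero_of_mul hx2) (right_ne_zero_of_mul hx2)]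
      change _ = f x.1 * ((x.2.factorization p : ℂ) * g x.2) +
        ((x.1.factorization p : ℂ) * f x.1) * g x.2
      simp only [Finsupp.add_apply, Nat.cast_add]
      ring

theorem factorizationDerivation_apply (p : ℕ) (f : ArithmeticFunction ℂ) (n : ℕ) :
    factorizationDerivation p f n = (n.factorization p : ℂ) * f n := rfl

/-- The coefficients `(-log n) ^ j * a n` of the `j`-th derivative of the Dirichlet series with
coefficients `a n`. -/
def derivCoeff (a : ArithmeticFunction ℂ) (j : ℕ) : ArithmeticFunction ℂ :=
  ⟨fun n => (-(Real.log n : ℂ)) ^ j * a n, by simp⟩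

theorem derivCoeff_apply (a : ArithmeticFunction ℂ) (j n : ℕ) :
    derivCoeff a j n = (-(Real.log n : ℂ)) ^ j * a n := rfl

/-- If `b` vanishes below `m < p`, then only the divisor `p` of `m * p` contributes to the
coefficient of `b * factorizationDerivation p f` at `m * p`. -/
theorem mul_factorizationDerivation_apply {b : ArithmeticFunction ℂ} (f : ArithmeticFunction ℂ)
    {m p : ℕ} (hm : m ≠ 0) (hb : ∀ d < m, b d = 0) (hp : p.Prime) :
    (b * factorizationDerivation p f) (m * p) = b m * f p := by
  rw [ArithmeticFunction.mul_apply, Finset.sum_eq_single (m, p)]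
  · simp [factorizationDerivation_apply, hp.factorization_self]
  · rintro ⟨d, n⟩ hdn hne
    obtain ⟨h1, h2⟩ := Nat.mem_divisorsAntidiagonal.1 hdn
    dsimp only at h1 ⊢
    rcases lt_or_ge d m with hd | hd
    · rw [hb d hd, zero_mul]
    · rw [factorizationDerivation_apply]
      by_cases hpn : p ∣ n
      · exfalso
        obtain ⟨k, rfl⟩ := hpn
        have hk : d * k = m := by
          apply Nat.eq_of_mul_eq_mul_right hp.pos
          rw [← h1]; ring
        have hk0 : k ≠ 0 := by rintro rfl; exact hm (by simpa using hk.symm)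
        have hk1 : k = 1 := by
          by_contra hk1
          have h3 : 2 ≤ k := by omega
          nlinarith [Nat.pos_of_ne_zero hm]
        subst hk1
        exact hne (by simp_all)
      · rw [Nat.factorization_eq_zero_of_not_dvd hpn]
        simp
  · intro h
    exact absurd (Nat.mem_divisorsAntidiagonal.2 ⟨rfl, mul_ne_zero hm hp.ne_zero⟩) h

open MvPolynomial in
/-- A formal Dirichlet series whose support contains infinitely many primes satisfies no algebraic
differential equation over `ℂ`. For a relation `P` of least degree, apply
`factorizationDerivation p` and compare coefficients at `m * p`, where `m` is the first index at
which some partial derivative of `P` does not vanish: `-log p` is a root of a polynomial that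
does not depend on `p`. -/
theorem algebraicIndependent_derivCoeff {a : ArithmeticFunction ℂ}
    (ha : {p : ℕ | p.Prime ∧ a p ≠ 0}.Infinite) :
    AlgebraicIndependent ℂ (derivCoeff a) := by
  rw [algebraicIndependent_iff]
  intro P
  induction hd : P.totalDegree using Nat.strong_induction_on generalizing P with
  | _ d ih =>
  intro hP
  by_cases hall : ∀ i, aeval (derivCoeff a) (pderiv i P) = 0
  · have hpd : ∀ i, pderiv i P = 0 := by
      intro i
      by_contra h
      exact h (ih _ (hd ▸ totalDegree_pderiv_lt h) _ rfl (hall i))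
    rw [eq_C_of_pderiv_eq_zero hpd] at hP ⊢
    rw [aeval_C] at hP
    have h1 := congrArg (fun f : ArithmeticFunction ℂ => f 1) hP
    simp only [ArithmeticFunction.algebraMap_apply_one, ArithmeticFunction.zero_apply] at h1
    rw [show coeff 0 P = 0 from h1, map_zero]
  exfalso
  set b : ℕ → ArithmeticFunction ℂ := fun i => aeval (derivCoeff a) (pderiv i P) with hb
  have hex : ∃ m, ∃ i, b i m ≠ 0 := by
    push Not at hall
    obtain ⟨i, hi⟩ := hall
    obtain ⟨m, hm⟩ := not_forall.1 (mt (fun h => ArithmeticFunction.ext h) hi)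
    exact ⟨m, i, hm⟩
  classical
  obtain ⟨i₀, hi₀⟩ := Nat.find_spec hex
  set m := Nat.find hex
  have hlt : ∀ i, ∀ d < m, b i d = 0 := fun i d hdm => by
    by_contra h
    exact Nat.find_min hex hdm ⟨i, h⟩
  have hm0 : m ≠ 0 := by
    intro h
    rw [h] at hi₀
    exact hi₀ (ArithmeticFunction.map_zero)
  -- By the choice of `m`, the coefficient at `m * p` of the chain rule for `P` is `a p` times the
  -- value of this polynomial at `-log p`.
  set q : Polynomial ℂ := ∑ i ∈ P.vars, Polynomial.C (b i m) * Polynomial.X ^ i with hq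
  have hroot : ∀ p : ℕ, p.Prime → a p ≠ 0 → q.eval (-(Real.log p : ℂ)) = 0 := by
    intro p hp hap
    have h1 := congrArg (fun f : ArithmeticFunction ℂ => f (m * p))
      (derivation_aeval_eq_sum (factorizationDerivation p) (derivCoeff a) P)
    rw [hP, map_zero] at h1
    have h2 : ∑ i ∈ P.vars, b i m * derivCoeff a i p = 0 := by
      rw [← Finset.sum_congr rfl fun i _ =>
        mul_factorizationDerivation_apply (derivCoeff a i) hm0 (hlt i) hp]
      refine Eq.trans ?_ h1.symm
      let coeffHom : ArithmeticFunction ℂ →+ ℂ := ⟨⟨fun f => f (m * p), rfl⟩, fun _ _ => rfl⟩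
      exact (map_sum coeffHom (fun i => b i * factorizationDerivation p (derivCoeff a i)) _).symm
    simp only [derivCoeff_apply, ← mul_assoc, ← Finset.sum_mul] at h2
    simpa [hq, Polynomial.eval_finsetSum] using (mul_eq_zero.1 h2).resolve_right hap
  have hinj : Set.InjOn (fun p : ℕ => -(Real.log p : ℂ)) {p : ℕ | p.Prime ∧ a p ≠ 0} := by
    intro p hp r hr h
    have h1 : Real.log p = Real.log r := by exact_mod_cast neg_injective h
    exact_mod_cast Real.log_injOn_pos (Set.mem_Ioi.2 (by exact_mod_cast hp.1.pos))
      (Set.mem_Ioi.2 (by exact_mod_cast hr.1.pos)) h1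
  have hq0 : q = 0 := Polynomial.eq_zero_of_infinite_isRoot q <|
    (ha.image hinj).mono (by rintro _ ⟨p, hp, rfl⟩; exact hroot p hp.1 hp.2)
  have hcoef : q.coeff i₀ = b i₀ m := by
    rw [hq, Polynomial.finsetSum_coeff]
    simp only [Polynomial.coeff_C_mul, Polynomial.coeff_X_pow, mul_ite, mul_one, mul_zero,
      Finset.sum_ite_eq]
    split_ifs with hi
    · rfl
    · simp [hb, pderiv_eq_zero_of_notMem_vars hi]
  exact hi₀ (by rw [← hcoef, hq0, Polynomial.coeff_zero])

/-! ### Independence of the variable from Dirichlet series -/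

/-- Removing the first term of a Dirichlet series leaves an exponentially small remainder, even
after multiplication by a power of the variable. -/
theorem tendsto_pow_mul_LSeries_sub {f : ℕ → ℂ} {k : ℕ} (h : ∀ m ≤ k, f m = 0)
    (hs : ∀ N : ℕ, 2 ≤ N → LSeriesSummable f N) (i : ℕ) :
    Tendsto (fun N : ℕ => (N : ℂ) ^ i * (((k : ℂ) + 1) ^ N * LSeries f N - f (k + 1))) atTop
      (𝓝 0) := by
  -- The series of `g` decays like `(k + 2) ^ (-N)`, which beats `N ^ i * (k + 1) ^ N`.
  set g : ℕ → ℂ := Function.update f (k + 1) 0 with hg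
  have hterm : ∀ (s : ℂ) (n : ℕ),
      LSeries.term g s n = if n = k + 1 then 0 else LSeries.term f s n := by
    intro s n
    rcases eq_or_ne n (k + 1) with rfl | hn
    · simp [LSeries.term, hg]
    · simp [LSeries.term, hg, hn]
  have hgs : ∀ N : ℕ, 2 ≤ N → LSeriesSummable g N := by
    intro N hN
    refine Summable.of_norm_bounded (hs N hN).norm fun n => ?_
    rw [hterm]
    split_ifs
    · simp
    · exact le_rfl
  have hg0 : ∀ m ≤ k + 1, g m = 0 := by
    intro m hm
    rcases eq_or_ne m (k + 1) with rfl | hn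
    · simp [hg]
    · simp only [hg, Function.update_of_ne hn]
      exact h m (by omega)
  have hga : LSeries.abscissaOfAbsConv g < ⊤ :=
    (hgs 2 le_rfl).abscissaOfAbsConv_le.trans_lt (EReal.coe_lt_top _)
  have hlim := (LSeries.tendsto_cpow_mul_atTop hg0 hga).comp tendsto_natCast_atTop_atTop
  have hr : ((k : ℝ) + 1) / (k + 2) < 1 := (div_lt_one (by positivity)).2 (by linarith)
  have hpow : Tendsto (fun N : ℕ => (((N : ℝ) ^ i * (((k : ℝ) + 1) / (k + 2)) ^ N : ℝ) : ℂ)) atTop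
      (𝓝 ((0 : ℝ) : ℂ)) :=
    (tendsto_pow_const_mul_const_pow_of_lt_one i (by positivity) hr).ofReal
  have hmul := hpow.mul hlim
  rw [Complex.ofReal_zero, zero_mul] at hmul
  refine hmul.congr' ?_
  filter_upwards [eventually_ge_atTop 2] with N hN
  have hk1 : ((k : ℂ) + 1) ≠ 0 := Nat.cast_add_one_ne_zero k
  have hk2 : ((k : ℂ) + 2) ≠ 0 := by exact_mod_cast (Nat.succ_ne_zero (k + 1))
  have hsum : LSeries f N = f (k + 1) / ((k : ℂ) + 1) ^ N + LSeries g N := by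
    rw [LSeries, (hs N hN).tsum_eq_add_tsum_ite (k + 1), LSeries]
    congr 1
    · rw [LSeries.term_of_ne_zero (Nat.succ_ne_zero k)]
      simp
    · exact tsum_congr fun n => (hterm _ n).symm
  rw [hsum, mul_add, mul_div_cancel₀ _ (pow_ne_zero _ hk1)]
  simp only [Function.comp_apply]
  push_cast
  rw [show (k : ℂ) + 1 + 1 = k + 2 by ring, Complex.cpow_natCast, div_pow]
  field_simp
  ring

theorem polynomial_eq_zero_of_tendsto {q : Polynomial ℂ}
    (h : Tendsto (fun N : ℕ => q.eval (N : ℂ)) atTop (𝓝 0)) : q = 0 := by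
  have hN : Tendsto (fun N : ℕ => ‖(N : ℂ)‖) atTop atTop := by
    simpa using tendsto_natCast_atTop_atTop (R := ℝ)
  rcases lt_or_ge 0 q.degree with hd | hd
  · exact absurd (Polynomial.tendsto_norm_atTop q hd hN)
      (not_tendsto_atTop_of_tendsto_nhds h.norm)
  · rw [Polynomial.eq_C_of_degree_le_zero hd] at h ⊢
    simp only [Polynomial.eval_C] at h
    rw [tendsto_nhds_unique tendsto_const_nhds h, map_zero]

/-- The identity function is transcendental over convergent Dirichlet series: at the first index
where some coefficient is non-zero, the coefficients of the series form a polynomial that tends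
to zero at infinity. -/
theorem eq_zero_of_sum_pow_mul_LSeries_eq_zero {n : ℕ} {A : ℕ → ArithmeticFunction ℂ}
    (hs : ∀ i, ∀ N : ℕ, 2 ≤ N → LSeriesSummable (A i) N)
    (h : ∀ N : ℕ, 2 ≤ N → ∑ i ∈ Finset.range n, (N : ℂ) ^ i * LSeries (A i) N = 0) :
    ∀ i < n, A i = 0 := by
  suffices H : ∀ m, ∀ i < n, A i m = 0 from
    fun i hi => ArithmeticFunction.ext fun m => H m i hi
  intro m
  induction m using Nat.strong_induction_on with
  | _ m ih =>
  rcases m with _ | k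
  · exact fun i _ => ArithmeticFunction.map_zero
  set q : Polynomial ℂ :=
    ∑ i ∈ Finset.range n, Polynomial.C (A i (k + 1)) * Polynomial.X ^ i with hq
  have hlim : Tendsto (fun N : ℕ => ∑ i ∈ Finset.range n,
      (N : ℂ) ^ i * (((k : ℂ) + 1) ^ N * LSeries (A i) N - A i (k + 1))) atTop (𝓝 0) := by
    rw [← Finset.sum_const_zero (s := Finset.range n)]
    exact tendsto_finsetSum _ fun i hi => tendsto_pow_mul_LSeries_sub
      (fun m hm => ih m (Nat.lt_succ_of_le hm) i (Finset.mem_range.1 hi)) (hs i) i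
  have hq0 : q = 0 := by
    apply polynomial_eq_zero_of_tendsto
    rw [← neg_zero]
    refine hlim.neg.congr' ?_
    filter_upwards [eventually_ge_atTop 2] with N hN
    have h1 : ∑ i ∈ Finset.range n, (N : ℂ) ^ i * (((k : ℂ) + 1) ^ N * LSeries (A i) N) = 0 := by
      rw [← mul_zero (((k : ℂ) + 1) ^ N), ← h N hN, Finset.mul_sum]
      exact Finset.sum_congr rfl fun i _ => by ring
    simp only [mul_sub, Finset.sum_sub_distrib, h1, hq, Polynomial.eval_finsetSum,
      Polynomial.eval_mul, Polynomial.eval_C, Polynomial.eval_pow, Polynomial.eval_X]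
    rw [zero_sub, neg_neg]
    exact Finset.sum_congr rfl fun i _ => mul_comm _ _
  intro i hi
  have hcoef : q.coeff i = A i (k + 1) := by
    simp [hq, Polynomial.finsetSum_coeff, Polynomial.coeff_X_pow, hi]
  rw [← hcoef, hq0, Polynomial.coeff_zero]

/-! ### Differential polynomials in convergent Dirichlet series -/

theorem iterate_logMul_apply (f : ℕ → ℂ) (j n : ℕ) :
    (LSeries.logMul^[j] f) n = (Real.log n : ℂ) ^ j * f n := by
  induction j with
  | zero => simp
  | succ j ih =>
    rw [Function.iterate_succ_apply', LSeries.logMul, ih, pow_succ, Complex.natCast_log]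
    ring

theorem derivCoeff_eq (a : ArithmeticFunction ℂ) (j : ℕ) :
    (derivCoeff a j : ℕ → ℂ) = ((-1 : ℂ) ^ j) • LSeries.logMul^[j] a := by
  ext n
  rw [derivCoeff_apply, Pi.smul_apply, iterate_logMul_apply, neg_pow, smul_eq_mul, mul_assoc]

open MvPolynomial in
/-- Evaluating a differential polynomial at a Dirichlet series that converges absolutely for
`1 < re s` amounts to evaluating it formally in the convolution ring of its coefficients. -/
theorem LSeries_aeval_derivCoeff {a : ArithmeticFunction ℂ} {F : ℂ → ℂ}
    (ha : ∀ s : ℂ, 1 < s.re → LSeriesSummable a s)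
    (hF : ∀ s : ℂ, 1 < s.re → F s = LSeries a s) (P : MvPolynomial ℕ ℂ) {s : ℂ}
    (hs : 1 < s.re) :
    LSeriesSummable (aeval (derivCoeff a) P : ArithmeticFunction ℂ) s ∧
      LSeries (aeval (derivCoeff a) P : ArithmeticFunction ℂ) s =
        aeval (fun j => iteratedDeriv j F s) P := by
  have habs : LSeries.abscissaOfAbsConv a < s.re := by
    obtain ⟨x, hx1, hx2⟩ := exists_between hs
    exact (ha x (by simpa using hx1)).abscissaOfAbsConv_le.trans_lt (by exact_mod_cast hx2)
  induction P using MvPolynomial.induction_on with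
  | C c =>
    rw [aeval_C, aeval_C, Algebra.algebraMap_eq_smul_one]
    have h1 : (⇑(c • (1 : ArithmeticFunction ℂ)) : ℕ → ℂ) = c • LSeries.delta := by
      rw [← ArithmeticFunction.one_eq_delta]; rfl
    rw [h1, LSeries_smul, LSeries_delta]
    refine ⟨LSeriesSummable.smul c ?_, by simp⟩
    exact summable_of_ne_finset_zero (s := {1}) fun n hn => by
      rw [LSeries.term_delta, if_neg (by simpa using hn)]
  | add P Q hP hQ =>
    rw [map_add, map_add]
    have h1 : (⇑(aeval (derivCoeff a) P + aeval (derivCoeff a) Q : ArithmeticFunction ℂ) : ℕ → ℂ)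
      = ⇑(aeval (derivCoeff a) P : ArithmeticFunction ℂ) +
        ⇑(aeval (derivCoeff a) Q : ArithmeticFunction ℂ) := rfl
    rw [h1, LSeries_add hP.1 hQ.1, hP.2, hQ.2]
    exact ⟨hP.1.add hQ.1, rfl⟩
  | mul_X P j hP =>
    have hj : LSeriesSummable (derivCoeff a j) s := by
      rw [derivCoeff_eq]
      exact (LSeriesSummable_of_abscissaOfAbsConv_lt_re (by simpa using habs)).smul _
    have hj' : LSeries (derivCoeff a j) s = iteratedDeriv j F s := by
      rw [derivCoeff_eq, LSeries_smul, ← LSeries_iteratedDeriv j habs]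
      refine (EventuallyEq.iteratedDeriv_eq j ?_).symm
      filter_upwards [(isOpen_lt continuous_const Complex.continuous_re).mem_nhds hs] with w hw
      exact hF w hw
    rw [map_mul, map_mul, aeval_X, aeval_X, ArithmeticFunction.LSeries_mul' hP.1 hj, hP.2, hj']
    exact ⟨ArithmeticFunction.LSeriesSummable_mul hP.1 hj, rfl⟩

/-! ### Transfer to the field of meromorphic functions -/

theorem meromorphic_iteratedDeriv {f : ℂ → ℂ} (hf : Meromorphic f) (n : ℕ) :
    Meromorphic (iteratedDeriv n f) := by
  rw [iteratedDeriv_eq_iterate]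
  exact hf.iterated_deriv

theorem iterate_deriv_toMero {f : ℂ → ℂ} (hf : Meromorphic f) (n : ℕ) :
    (fun y : MeroField => y′)^[n] (toMero f hf) =
      toMero (iteratedDeriv n f) (meromorphic_iteratedDeriv hf n) := by
  induction n with
  | zero => simp
  | succ n ih =>
    rw [Function.iterate_succ_apply', ih, deriv_toMero]
    simp only [iteratedDeriv_succ]

/-- The class of a meromorphic function, as a homomorphism of `ℂ`-algebras. -/
def meroMkₐ : meroAlg →ₐ[ℂ] MeroField := { meroMk with commutes' := fun _ => rfl }

/-- Evaluation of a meromorphic function at a point; its value at a pole is arbitrary. -/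
def meroEval (s : ℂ) : meroAlg →ₐ[ℂ] ℂ := (Pi.evalAlgHom ℂ (fun _ : ℂ => ℂ) s).comp meroAlg.val

theorem eqOn_zero_of_eventually_codiscrete {G : ℂ → ℂ} {U : Set ℂ}
    (h : G =ᶠ[codiscrete ℂ] 0) (hG : ∀ s ∈ U, ContinuousAt G s) : ∀ s ∈ U, G s = 0 := by
  intro s hs
  have h1 : ∀ᶠ z in 𝓝[≠] s, G z = 0 := by
    rw [EventuallyEq, Filter.Eventually, codiscrete,
      mem_codiscreteWithin_iff_forall_mem_nhdsNE] at h
    filter_upwards [h s (Set.mem_univ s)] with z hz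
    simpa using hz
  refine tendsto_nhds_unique (l := 𝓝[≠] s) ((hG s hs).tendsto.mono_left nhdsWithin_le_nhds)
    (tendsto_const_nhds.congr' ?_)
  filter_upwards [h1] with z hz using hz.symm

open MvPolynomial in
/-- A relation over `ℂ` between `z` and the derivatives of `f` in the field of meromorphic
functions, written as a polynomial in `z`, is trivial when `f` is given for `1 < re s` by an
absolutely convergent Dirichlet series supported at infinitely many primes. -/
theorem eq_zero_of_sum_pow_mul_aeval_eq_zero {f : ℂ → ℂ} (hf : Meromorphic f)
    {a : ArithmeticFunction ℂ} (ha : ∀ s : ℂ, 1 < s.re → LSeriesSummable a s)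
    (hfa : ∀ s : ℂ, 1 < s.re → f s = LSeries a s)
    (hp : {p : ℕ | p.Prime ∧ a p ≠ 0}.Infinite) (n : ℕ) (P : ℕ → MvPolynomial ℕ ℂ)
    (h : ∑ i ∈ Finset.range n, toMero (fun z => z) meromorphic_id ^ i *
      aeval (fun j => (fun y : MeroField => y′)^[j] (toMero f hf)) (P i) = 0) :
    ∀ i < n, P i = 0 := by
  set Z : meroAlg := ⟨fun z => z, meromorphic_id⟩
  set g : ℕ → meroAlg := fun j => ⟨iteratedDeriv j f, meromorphic_iteratedDeriv hf j⟩
  set E : meroAlg := ∑ i ∈ Finset.range n, Z ^ i * aeval g (P i) with hE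
  have hE0 : (E : ℂ → ℂ) =ᶠ[codiscrete ℂ] 0 := by
    rw [← mem_nullIdeal]
    refine Ideal.Quotient.eq_zero_iff_mem.1 ?_
    change meroMkₐ E = 0
    rw [← h, hE, map_sum]
    refine Finset.sum_congr rfl fun i _ => ?_
    rw [map_mul, map_pow, ← AlgHom.comp_apply, comp_aeval]
    congr 2
    exact congrArg aeval (funext fun j => (iterate_deriv_toMero hf j).symm)
  have hEs : ∀ s, (E : ℂ → ℂ) s =
      ∑ i ∈ Finset.range n, s ^ i * aeval (fun j => iteratedDeriv j f s) (P i) := by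
    intro s
    change meroEval s E = _
    rw [hE, map_sum]
    refine Finset.sum_congr rfl fun i _ => ?_
    rw [map_mul, map_pow, ← AlgHom.comp_apply, comp_aeval]
    rfl
  have habs : LSeries.abscissaOfAbsConv a ≤ 1 :=
    LSeries.abscissaOfAbsConv_le_of_forall_lt_LSeriesSummable' fun y hy =>
      ha y (by simpa using (by exact_mod_cast hy : (1 : ℝ) < y))
  have hopen : IsOpen {s : ℂ | 1 < s.re} := isOpen_lt continuous_const Complex.continuous_re
  have han : AnalyticOnNhd ℂ f {s : ℂ | 1 < s.re} :=
    ((LSeries_analyticOnNhd a).mono fun s hs =>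
      habs.trans_lt (by exact_mod_cast hs)).congr hopen fun s hs => (hfa s hs).symm
  have hcont : ∀ s ∈ {s : ℂ | 1 < s.re}, ContinuousAt (E : ℂ → ℂ) s := by
    intro s hs
    rw [show (E : ℂ → ℂ) = fun s => ∑ i ∈ Finset.range n,
      s ^ i * aeval (fun j => iteratedDeriv j f s) (P i) from funext hEs]
    refine tendsto_finsetSum _ fun i _ => (continuousAt_id.pow i).mul ?_
    have hev : Continuous fun x : ℕ → ℂ => aeval x (P i) := by
      simpa [coe_aeval_eq_eval] using MvPolynomial.continuous_eval (P i)
    exact hev.continuousAt.comp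
      (continuousAt_pi.2 fun j => by
        rw [iteratedDeriv_eq_iterate]
        exact (han.iterated_deriv j s hs).continuousAt)
  have hzero := eqOn_zero_of_eventually_codiscrete hE0 hcont
  have hN : ∀ N : ℕ, 2 ≤ N → 1 < (N : ℂ).re := fun N hN => by
    simpa using (by exact_mod_cast hN : 1 < (N : ℝ))
  have hA := eq_zero_of_sum_pow_mul_LSeries_eq_zero (n := n)
    (A := fun i => aeval (derivCoeff a) (P i))
    (fun i N h2 => (LSeries_aeval_derivCoeff ha hfa (P i) (hN N h2)).1) (fun N h2 => by
      rw [← hzero N (hN N h2), hEs]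
      exact Finset.sum_congr rfl fun i _ => by
        rw [(LSeries_aeval_derivCoeff ha hfa (P i) (hN N h2)).2])
  exact fun i hi => (algebraicIndependent_iff.1 (algebraicIndependent_derivCoeff hp)) _ (hA i hi)

/-- A meromorphic function given for `1 < re s` by an absolutely convergent Dirichlet series whose
support contains infinitely many primes is differentially transcendental over `ℂ(z)`. -/
theorem isDiffTranscendental_of_LSeries {f : ℂ → ℂ} (hf : Meromorphic f)
    {a : ArithmeticFunction ℂ} (ha : ∀ s : ℂ, 1 < s.re → LSeriesSummable a s)
    (hfa : ∀ s : ℂ, 1 < s.re → f s = LSeries a s)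
    (hp : {p : ℕ | p.Prime ∧ a p ≠ 0}.Infinite) : IsDiffTranscendental f := by
  refine ⟨hf, ?_⟩
  set z : MeroField := toMero (fun z => z) meromorphic_id with hz
  set y : ℕ → MeroField := fun j => (fun y : MeroField => y′)^[j] (toMero f hf) with hy
  have key := eq_zero_of_sum_pow_mul_aeval_eq_zero hf ha hfa hp
  have h1 : AlgebraicIndependent ℂ y := by
    rw [algebraicIndependent_iff]
    intro P hP
    exact key 1 (fun _ => P) (by simpa using hP) 0 one_pos
  have h2 : Transcendental (Algebra.adjoin ℂ (Set.range y)) z := by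
    rw [transcendental_iff]
    intro q hq
    have hc : ∀ i, ∃ P : MvPolynomial ℕ ℂ, MvPolynomial.aeval y P = (q.coeff i : MeroField) := by
      intro i
      exact (Algebra.adjoin_range_eq_range_aeval ℂ y).le (q.coeff i).2
    choose P hP using hc
    have h3 := key (q.natDegree + 1) P (by
      rw [← hq, Polynomial.aeval_eq_sum_range]
      exact Finset.sum_congr rfl fun i _ => by
        rw [hP i, Algebra.smul_def, mul_comm]
        rfl)
    ext i
    rcases lt_or_ge i (q.natDegree + 1) with hi | hi
    · rw [← hP i, h3 i hi]
      simp
    · rw [Polynomial.coeff_eq_zero_of_natDegree_lt hi, Polynomial.coeff_zero]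
  -- Independence of `z, f, f', …` over `ℂ` gives independence of `f, f', …` over `ℂ[z]`, hence
  -- over its fraction field.
  have h4 : AlgebraicIndependent ℂ (Sum.elim y fun _ : Unit => z) := by
    rw [← algebraicIndependent_equiv' (Equiv.optionEquivSumPUnit ℕ)
      (g := fun o : Option ℕ => o.elim z y) (by ext o; cases o <;> rfl)]
    exact AlgebraicIndependent.option_iff.2 ⟨h1, h2⟩
  have h5 := (AlgebraicIndependent.sumElim_iff.1 h4).2
  rw [Set.range_const] at h5
  have h6 : AlgebraicIndependent ratField y :=
    IntermediateField.algebraicIndependent_adjoin_iff.2 h5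
  rintro ⟨p, hp0, hp⟩
  exact hp0 (algebraicIndependent_iff.1 h6 p hp)

/-! ### Functions with periodic coefficients -/

theorem meromorphic_LFunction {N : ℕ} [NeZero N] (Φ : ZMod N → ℂ) :
    Meromorphic (ZMod.LFunction Φ) := by
  have hd : ∀ z : ℂ, z ≠ 1 → DifferentiableAt ℂ (ZMod.LFunction Φ) z :=
    fun z hz => ZMod.differentiableAt_LFunction Φ z (Or.inl hz)
  intro s
  rcases eq_or_ne s 1 with rfl | hs
  · -- The product with `s - 1` extends analytically to `1`, with the residue as its value there.
    set g : ℂ → ℂ := Function.update (fun s => (s - 1) * ZMod.LFunction Φ s) 1 (∑ j, Φ j / N)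
    have hg : AnalyticAt ℂ g 1 := by
      refine Complex.analyticAt_of_differentiable_on_punctured_nhds_of_continuousAt ?_
        (continuousAt_update_same.2 (ZMod.LFunction_residue_one Φ))
      filter_upwards [self_mem_nhdsWithin] with z hz
      refine DifferentiableAt.congr_of_eventuallyEq
        ((differentiableAt_id.sub_const 1).mul (hd z hz)) ?_
      filter_upwards [isOpen_ne.mem_nhds hz] with w hw
      exact Function.update_of_ne hw _ _
    refine ((hg.meromorphicAt.mul (((MeromorphicAt.id 1).sub (MeromorphicAt.const 1 1)).inv))).congr
      ?_
    filter_upwards [self_mem_nhdsWithin] with z hz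
    have hz' : z - 1 ≠ 0 := sub_ne_zero.2 hz
    simp only [Pi.mul_apply, Pi.inv_apply, Pi.sub_apply, id_eq, g, Function.update_of_ne hz]
    field_simp
  · have : AnalyticAt ℂ (ZMod.LFunction Φ) s := by
      refine DifferentiableOn.analyticAt (s := {1}ᶜ) (fun z hz => ?_)
        (isOpen_compl_singleton.mem_nhds hs)
      exact (hd z hz).differentiableWithinAt
    exact this.meromorphicAt

/-- The zeta, eta and `L`-functions in question are all of this kind: Dirichlet series with periodic
coefficients that do not vanish at large primes. -/
theorem isDiffTranscendental_LFunction {N : ℕ} [NeZero N] (Φ : ZMod N → ℂ)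
    (hΦ : ∀ p : ℕ, p.Prime → N < p → Φ p ≠ 0) : IsDiffTranscendental (ZMod.LFunction Φ) := by
  set a : ArithmeticFunction ℂ := ⟨fun n => if n = 0 then 0 else Φ n, by simp⟩ with ha
  have haΦ : ∀ {n : ℕ}, n ≠ 0 → a n = Φ n := fun {n} hn => if_neg hn
  refine isDiffTranscendental_of_LSeries (a := a) (meromorphic_LFunction Φ) (fun s hs => ?_)
    (fun s hs => ?_) ?_
  · exact (LSeriesSummable_congr s fun hn => haΦ hn).2 (ZMod.LSeriesSummable_of_one_lt_re Φ hs)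
  · rw [ZMod.LFunction_eq_LSeries Φ hs]
    exact LSeries_congr (fun hn => (haΦ hn).symm) s
  · refine (Nat.infinite_setOfPred_prime.sdiff (Set.finite_Iic N)).mono ?_
    rintro p ⟨hp, hpN⟩
    refine ⟨hp, ?_⟩
    rw [haΦ hp.ne_zero]
    exact hΦ p hp (not_le.1 hpN)

theorem isDiffTranscendental_dirichletLFunction {N : ℕ} [NeZero N] (χ : DirichletCharacter ℂ N) :
    IsDiffTranscendental χ.LFunction :=
  isDiffTranscendental_LFunction χ fun p hp hN => by
    have hu : IsUnit (p : ZMod N) := (ZMod.isUnit_iff_coprime p N).2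
      ((Nat.Prime.coprime_iff_not_dvd hp).2 fun h =>
        absurd (Nat.le_of_dvd (NeZero.pos N) h) (not_le.2 hN))
    exact (hu.map χ).ne_zero

theorem isDiffTranscendental_riemannZeta : IsDiffTranscendental riemannZeta := by
  have h : ZMod.LFunction (fun _ : ZMod 1 => (1 : ℂ)) = riemannZeta :=
    funext fun s => by rw [ZMod.LFunction_modOne_eq, one_mul]
  rw [← h]
  exact isDiffTranscendental_LFunction _ fun _ _ _ => one_ne_zero

theorem isDiffTranscendental_dirichletEta : IsDiffTranscendental dirichletEta :=
  isDiffTranscendental_LFunction _ fun p _ _ => by split_ifs <;> simp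

/-! ### The series of the eta and beta functions -/

theorem hasSum_LFunction {N : ℕ} [NeZero N] (Φ : ZMod N → ℂ) {s : ℂ} (hs : 1 < s.re) :
    HasSum (fun n : ℕ => Φ n / (n : ℂ) ^ s) (ZMod.LFunction Φ s) := by
  rw [ZMod.LFunction_eq_LSeries Φ hs]
  refine (ZMod.LSeriesSummable_of_one_lt_re Φ hs).hasSum.congr_fun fun n => ?_
  exact (LSeries.term_of_ne_zero' (Complex.ne_zero_of_one_lt_re hs) (Φ ·) n).symm

theorem hasSum_dirichletEta {s : ℂ} (hs : 1 < s.re) :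
    HasSum (fun n : ℕ => (-1 : ℂ) ^ n / ((n : ℂ) + 1) ^ s) (dirichletEta s) := by
  have h := hasSum_LFunction (fun a : ZMod 2 => if a = 0 then (-1 : ℂ) else 1) hs
  have hs0 : s ≠ 0 := Complex.ne_zero_of_one_lt_re hs
  rw [← hasSum_nat_add_iff' 1] at h
  simp only [Finset.range_one, Finset.sum_singleton, Nat.cast_zero, Complex.zero_cpow hs0, div_zero,
    sub_zero] at h
  refine h.congr_fun fun n => ?_
  rcases Nat.even_or_odd n with hn | hn
  · have h1 : ((n + 1 : ℕ) : ZMod 2) ≠ 0 := by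
      rw [Ne, ZMod.natCast_eq_zero_iff_even, Nat.not_even_iff_odd]
      exact hn.add_one
    rw [if_neg h1, hn.neg_one_pow]
    push_cast
    rfl
  · have h1 : ((n + 1 : ℕ) : ZMod 2) = 0 := (ZMod.natCast_eq_zero_iff_even).2 hn.add_one
    rw [if_pos h1, hn.neg_one_pow]
    push_cast
    rfl

/-- The odd part of the zeta series is the `L`-function of the trivial character modulo `2`. -/
theorem dirichletEta_eq {s : ℂ} (hs : s ≠ 1) :
    dirichletEta s = (1 - (2 : ℂ) ^ (1 - s)) * riemannZeta s := by
  have h := DirichletCharacter.LFunctionTrivChar_eq_mul_riemannZeta (N := 2) hs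
  have h2 : (2 : ℂ) ^ (1 - s) = 2 * (2 : ℂ) ^ (-s) := by
    rw [sub_eq_add_neg, Complex.cpow_add _ _ two_ne_zero, Complex.cpow_one]
  simp only [Nat.prime_two.primeFactors, Finset.prod_singleton] at h
  rw [DirichletCharacter.LFunctionTrivChar, DirichletCharacter.LFunction, ZMod.LFunction] at h
  rw [dirichletEta, ZMod.LFunction, h2]
  have hu : ∀ F : ZMod 2 → ℂ, ∑ j, F j = F 0 + F 1 := fun F => Fin.sum_univ_two F
  rw [hu] at h ⊢
  have h0 : (1 : DirichletCharacter ℂ 2) 0 = 0 := MulChar.map_zero 1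
  simp only [h0, map_zero, HurwitzZeta.hurwitzZeta_zero, map_one, zero_mul, zero_add, one_mul,
    Nat.cast_ofNat, if_true, one_ne_zero, if_false] at h ⊢
  linear_combination h

theorem hasSum_dirichletBeta {s : ℂ} (hs : 1 < s.re) :
    HasSum (fun n : ℕ => (-1 : ℂ) ^ n / (2 * (n : ℂ) + 1) ^ s) (dirichletBeta s) := by
  have h := hasSum_LFunction chiFour hs
  have hinj : Function.Injective fun n : ℕ => 2 * n + 1 := fun m n h => by
    simpa using h
  rw [← hinj.hasSum_iff] at h
  · refine h.congr_fun fun n => ?_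
    have h1 : chiFour ((2 * n + 1 : ℕ) : ZMod 4) = (-1) ^ n := by
      rw [chiFour, MulChar.ringHomComp_apply, ZMod.χ₄_eq_neg_one_pow (by omega),
        show (2 * n + 1) / 2 = n by omega]
      simp
    rw [Function.comp_apply, h1]
    push_cast
    rfl
  · intro n hn
    have h1 : chiFour (n : ZMod 4) = 0 := by
      have h2 : n % 2 = 0 := by
        by_contra h2
        exact hn ⟨n / 2, by dsimp only; omega⟩
      rw [chiFour, MulChar.ringHomComp_apply, ZMod.χ₄_nat_eq_if_mod_four, if_pos h2, map_zero]
    rw [h1, zero_div]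

end DiffTrans

end

theorem mainTheorem3 :
    -- the Riemann zeta function
    DiffTrans.IsDiffTranscendental riemannZeta ∧
    -- the `L`-function of every Dirichlet character
    (∀ (N : ℕ) [NeZero N] (χ : DirichletCharacter ℂ N),
      DiffTrans.IsDiffTranscendental χ.LFunction) ∧
    -- the Dirichlet eta function
    ((∀ s : ℂ, 1 < s.re →
        HasSum (fun n : ℕ => (-1 : ℂ) ^ n / ((n : ℂ) + 1) ^ s) (DiffTrans.dirichletEta s)) ∧
      (∀ s : ℂ, s ≠ 1 →
        DiffTrans.dirichletEta s = (1 - (2 : ℂ) ^ (1 - s)) * riemannZeta s) ∧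
      DiffTrans.IsDiffTranscendental DiffTrans.dirichletEta) ∧
    -- the Dirichlet beta function
    ((∀ s : ℂ, 1 < s.re →
        HasSum (fun n : ℕ => (-1 : ℂ) ^ n / (2 * (n : ℂ) + 1) ^ s) (DiffTrans.dirichletBeta s)) ∧
      DiffTrans.IsDiffTranscendental DiffTrans.dirichletBeta) :=
  ⟨DiffTrans.isDiffTranscendental_riemannZeta,
    fun _ _ χ => DiffTrans.isDiffTranscendental_dirichletLFunction χ,
    ⟨fun _ => DiffTrans.hasSum_dirichletEta, fun _ => DiffTrans.dirichletEta_eq,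
      DiffTrans.isDiffTranscendental_dirichletEta⟩,
    ⟨fun _ => DiffTrans.hasSum_dirichletBeta,
      DiffTrans.isDiffTranscendental_dirichletLFunction DiffTrans.chiFour⟩⟩
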